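/- Let $k$ be an arbitrary field and let $A=(a_1\mid\dots\mid a_{16})\in\mathbb{N}^{16\times 16}$ be the matrix $$A=\begin{pmatrix} 1'_2\otimes I_4\otimes I_2\\ I_4\otimes 1'_2\otimes I_2\end{pmatrix},\qquad 1'_2=(1\ \ 1),$$ where $I_n$ is the $n\times n$ identity matrix. It is the matrix of the binary marginal independence model induced by the undirected graph $G$ with vertices $1,2,3,4$ and edges $\{1,2\},\{2,3\},\{3,4\},\{4,1\},\{2,4\}$: for a suitable ordering of the rows, the columns correspond to the joint states $y\in\{0,1\}^4$ in lexicographic order, the rows correspond to the pairs $(K,x)$ with $K$ a maximal clique of $G$ and $x\in\{0,1\}^K$, and the entry is $1$ if $y|_K=x$ and $0$ otherwise. Let $\mathcal{A}\subseteq\mathbb{N}^{16}$ be the semigroup with zero generated by the columns $a_1,\dots,a_{16}$, and let $I_{\mathcal{A}}\subset R=k[X_1,\dots,X_{16}]$ be its toric ideal, that is, the kernel of the $k$-algebra map $R\to k[\mathcal{A}]$, $X_i\mapsto \mathbf{t}^{a_i}$. Grade $R$ by $\mathcal{A}$, giving $X_i$ the degree $a_i$. A degree $\mathbf{a}\in\mathcal{A}$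 is called indispensable if every inclusion-minimal system of $\mathcal{A}$-homogeneous generators of $I_{\mathcal{A}}$ contains exactly one polynomial of $\mathcal{A}$-degree $\mathbf{a}$; such a polynomial is called an indispensable binomial of $I_{\mathcal{A}}$. A binomial is a polynomial with exactly two terms. Then: (1) Up to multiplication by nonzero scalars, $I_{\mathcal{A}}$ has exactly four indispensable binomials, namely $$X_1X_{11}-X_3X_9,\quad X_2X_{12}-X_4X_{10},\quad X_5X_{15}-X_7X_{13},\quad X_6X_{16}-X_8X_{14}.$$ These four are pairwise not scalar multiples of each other, and, up to nonzero scalars, they are also exactly the binomials that belong, up to a nonzero scalar multiple, to every system of binomial generators of $I_{\mathcal{A}}$. (2) These four binomials generate $I_{\mathcal{A}}$. (3) $I_{\mathcal{A}}$ has a unique minimal system of binomial generators, up to multiplying its elements by nonzero scalars: the inclusion-minimal sets of binomials generating $I_{\mathcal{A}}$ are exactly the sets obtained from the four binomials above by multiplying each of them by a nonzero scalar. -/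

import Mathlib

open MvPolynomial

namespace SemigroupIdeal

section General

variable (k : Type*) [Field k] {M : Type*} [AddCommMonoid M] {r : ℕ} (a : Fin r → M)

/-- The semigroup with zero generated by `a 0, …, a (r - 1)` inside `M`. -/
abbrev semigroup : AddSubmonoid M := AddSubmonoid.closure (Set.range a)

/-- The chosen generators, as elements of the semigroup. -/
def gen (i : Fin r) : semigroup a :=
  ⟨a i, AddSubmonoid.subset_closure (Set.mem_range_self i)⟩

/-- The `k`-algebra map `k[X_1, …, X_r] → k[𝒜]`, `X_i ↦ t^{a_i}`. -/
noncomputable def toSemigroupAlgebra :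
    MvPolynomial (Fin r) k →ₐ[k] AddMonoidAlgebra k (semigroup a) :=
  aeval fun i => AddMonoidAlgebra.single (gen a i) (1 : k)

/-- The semigroup ideal `I_𝒜`. -/
noncomputable def semigroupIdeal : Ideal (MvPolynomial (Fin r) k) :=
  RingHom.ker (toSemigroupAlgebra k a)

variable {k}

/-- `f` is homogeneous of `𝒜`-degree `d`, where `X_i` has weight `a_i`. -/
def HasDegree (f : MvPolynomial (Fin r) k) (d : semigroup a) : Prop :=
  IsWeightedHomogeneous (gen a) f d

/-- A system of `𝒜`-homogeneous generators of `I_𝒜`. -/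
def IsHomogeneousSystem (S : Set (MvPolynomial (Fin r) k)) : Prop :=
  (∀ f ∈ S, ∃ d : semigroup a, HasDegree a f d) ∧ Ideal.span S = semigroupIdeal k a

/-- A polynomial with exactly two terms. -/
def IsBinomial (f : MvPolynomial (Fin r) k) : Prop :=
  ∃ (u v : Fin r →₀ ℕ) (α β : k), u ≠ v ∧ α ≠ 0 ∧ β ≠ 0 ∧ f = monomial u α - monomial v β

/-- A system of binomial generators of `I_𝒜`. -/
def IsBinomialSystem (S : Set (MvPolynomial (Fin r) k)) : Prop :=
  (∀ f ∈ S, IsBinomial f) ∧ Ideal.span S = semigroupIdeal k a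

variable (k) in
/-- `d` is an indispensable `𝒜`-degree of `I_𝒜`: every (inclusion-)minimal system of
`𝒜`-homogeneous generators contains one and only one polynomial of `𝒜`-degree `d`. -/
def IsIndispensableDegree (d : semigroup a) : Prop :=
  ∀ S : Set (MvPolynomial (Fin r) k), Minimal (IsHomogeneousSystem a) S →
    ∃! f, f ∈ S ∧ HasDegree a f d

/-- `f` is an indispensable binomial: it is the polynomial of `𝒜`-degree `d`, for an indispensable
degree `d`, of some minimal system of `𝒜`-homogeneous generators of `I_𝒜`. -/
def IsIndispensableBinomial (f : MvPolynomial (Fin r) k) : Prop :=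
  ∃ d : semigroup a, IsIndispensableDegree k a d ∧ HasDegree a f d ∧
    ∃ S : Set (MvPolynomial (Fin r) k), Minimal (IsHomogeneousSystem a) S ∧ f ∈ S

/-- `f` is a binomial which belongs, up to a nonzero scalar multiple, to every system of binomial
generators of `I_𝒜`. -/
def IsInEveryBinomialSystem (f : MvPolynomial (Fin r) k) : Prop :=
  IsBinomial f ∧ ∀ S : Set (MvPolynomial (Fin r) k), IsBinomialSystem a S →
    ∃ c : k, c ≠ 0 ∧ C c * f ∈ S

end General

/-- The matrix of the binary model of a graph `G`: the columns are indexed by the joint states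
`y ∈ {0,1}^V`, the rows by the pairs of a maximal clique and a joint state `x` of its vertices,
and the entry is `1` if `y` restricts to `x` on the clique and `0` otherwise. -/
def cliqueMarginalMatrix {V : Type*} [DecidableEq V] (G : SimpleGraph V) :
    Matrix (Σ K : {K : Finset V // Maximal (fun s : Finset V => G.IsClique s) K}, K.1 → Fin 2)
      (V → Fin 2) ℕ :=
  fun p y => if (fun v : p.1.1 => y v) = p.2 then 1 else 0

/-- The graph on the vertices 1, 2, 3, 4 (here 0, 1, 2, 3) with the edges
12, 23, 34, 41, 24. -/
def exampleGraph : SimpleGraph (Fin 4) :=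
  SimpleGraph.fromEdgeSet {s(0, 1), s(1, 2), s(2, 3), s(3, 0), s(1, 3)}

/-- The `j`-th joint state of the four binary variables in lexicographic order: the binary digits
of `j`, most significant digit first. -/
def state (j : Fin 16) : Fin 4 → Fin 2 :=
  fun v => Fin.ofNat 2 (j.val / 2 ^ (3 - v.val))

/-- The matrix of the example. -/
def exampleMatrix : Matrix (Fin 16) (Fin 16) ℕ :=
  !![1, 0, 0, 0, 0, 0, 0, 0, 1, 0, 0, 0, 0, 0, 0, 0;
     0, 1, 0, 0, 0, 0, 0, 0, 0, 1, 0, 0, 0, 0, 0, 0;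
     0, 0, 1, 0, 0, 0, 0, 0, 0, 0, 1, 0, 0, 0, 0, 0;
     0, 0, 0, 1, 0, 0, 0, 0, 0, 0, 0, 1, 0, 0, 0, 0;
     0, 0, 0, 0, 1, 0, 0, 0, 0, 0, 0, 0, 1, 0, 0, 0;
     0, 0, 0, 0, 0, 1, 0, 0, 0, 0, 0, 0, 0, 1, 0, 0;
     0, 0, 0, 0, 0, 0, 1, 0, 0, 0, 0, 0, 0, 0, 1, 0;
     0, 0, 0, 0, 0, 0, 0, 1, 0, 0, 0, 0, 0, 0, 0, 1;
     1, 0, 1, 0, 0, 0, 0, 0, 0, 0, 0, 0, 0, 0, 0, 0;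
     0, 1, 0, 1, 0, 0, 0, 0, 0, 0, 0, 0, 0, 0, 0, 0;
     0, 0, 0, 0, 1, 0, 1, 0, 0, 0, 0, 0, 0, 0, 0, 0;
     0, 0, 0, 0, 0, 1, 0, 1, 0, 0, 0, 0, 0, 0, 0, 0;
     0, 0, 0, 0, 0, 0, 0, 0, 1, 0, 1, 0, 0, 0, 0, 0;
     0, 0, 0, 0, 0, 0, 0, 0, 0, 1, 0, 1, 0, 0, 0, 0;
     0, 0, 0, 0, 0, 0, 0, 0, 0, 0, 0, 0, 1, 0, 1, 0;
     0, 0, 0, 0, 0, 0, 0, 0, 0, 0, 0, 0, 0, 1, 0, 1]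

/-- The generators of the semigroup of the example: the columns of the matrix. -/
def exampleColumns : Fin 16 → (Fin 16 → ℕ) := exampleMatrix.col

/-- The four binomials of the example; `X j` here is the variable with number `j + 1` in the
usual one-based numbering. -/
noncomputable def exampleBinomial (k : Type*) [Field k] : Fin 4 → MvPolynomial (Fin 16) k :=
  ![X 0 * X 10 - X 2 * X 8,
    X 1 * X 11 - X 3 * X 9,
    X 4 * X 14 - X 6 * X 12,
    X 5 * X 15 - X 7 * X 13]

end SemigroupIdeal

namespace SemigroupIdeal

/-! ### Semigroup ideals and fibers of the degree map. -/

section General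

variable {k : Type*} [Field k] {M : Type*} [AddCommMonoid M] {r : ℕ} {a : Fin r → M}

/-! The 16 variables split into four blocks `{b, b + 2, b + 8, b + 10}`, and every row of the matrix
meets a single block. An exponent vector is thus four 2×2 tables with rows `(b, b + 2)` and `(b + 8,
b + 10)`, and its degree records their row and column sums. Tables with equal margins differ by a
multiple of the alternating table, so the four determinants generate the ideal
(`semigroupIdeal_le_of_monomial_sub_mem`, `pow_mul_pow_eq_of_mul_eq`).

Uniqueness comes from fibers: the degree of a leading monomial contains only the two monomials of
that binomial, and the degree of a proper divisor only the divisor itself. Some generator in a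
homogeneous system must have a term dividing the leading monomial. A proper divisor would make that
generator zero, so it is a multiple of the binomial (`IsHomogeneousSystem.exists_C_mul_mem`). Hence
every system contains multiples of all four, and these already generate. Binomials in the ideal are
homogeneous, so `minimal_system_iff` covers both kinds of system. -/

theorem toSemigroupAlgebra_monomial (u : Fin r →₀ ℕ) (c : k) :
    toSemigroupAlgebra k a (monomial u c) =
      AddMonoidAlgebra.single (Finsupp.weight (gen a) u) c := by
  rw [toSemigroupAlgebra, aeval_monomial]
  have h : (u.prod fun i n => (AddMonoidAlgebra.single (gen a i) (1 : k)) ^ n) =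
      AddMonoidAlgebra.single (Finsupp.weight (gen a) u) 1 := by
    rw [Finsupp.weight_apply, Finsupp.prod, Finsupp.sum]
    induction u.support using Finset.induction_on with
    | empty => simp [AddMonoidAlgebra.one_def]
    | insert i s hi ih =>
      rw [Finset.prod_insert hi, Finset.sum_insert hi, ih, AddMonoidAlgebra.single_pow,
        AddMonoidAlgebra.single_mul_single, one_pow, one_mul]
  rw [h, AddMonoidAlgebra.coe_algebraMap]
  simp [AddMonoidAlgebra.single_mul_single]

theorem coe_weight_gen (u : Fin r →₀ ℕ) :
    ((Finsupp.weight (gen a) u : semigroup a) : M) = ∑ i, u i • a i := by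
  rw [Finsupp.weight_apply, Finsupp.sum_fintype _ _ (fun i => zero_smul ℕ (gen a i)),
    AddSubmonoid.coe_finsetSum]
  rfl

/-- An ideal contains the semigroup ideal as soon as it identifies the monomials of equal
degree. -/
theorem semigroupIdeal_le_of_monomial_sub_mem {J : Ideal (MvPolynomial (Fin r) k)}
    (h : ∀ u v : Fin r →₀ ℕ, Finsupp.weight (gen a) u = Finsupp.weight (gen a) v →
      Ideal.Quotient.mk J (monomial u 1) = Ideal.Quotient.mk J (monomial v 1)) :
    semigroupIdeal k a ≤ J := by
  classical
  intro f hf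
  -- `invFun` picks one monomial in each degree, so the class of `g` modulo `J` is recovered from
  -- its image in the semigroup algebra alone.
  have key : ∀ g : MvPolynomial (Fin r) k, Ideal.Quotient.mk J g =
      (toSemigroupAlgebra k a g).coeff.sum fun d c => Ideal.Quotient.mk J
        (monomial (Function.invFun (Finsupp.weight (gen a)) d) c) := by
    intro g
    induction g using MvPolynomial.induction_on' with
    | monomial u c =>
      rw [toSemigroupAlgebra_monomial, AddMonoidAlgebra.coeff_single,
        Finsupp.sum_single_index (by simp)]
      have hu := h u _ (Function.invFun_eq (f := Finsupp.weight (gen a)) ⟨u, rfl⟩).symm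
      have := congrArg (fun x => Ideal.Quotient.mk J (C c) * x) hu
      simpa only [← map_mul, C_mul_monomial, mul_one] using this
    | add p q hp hq =>
      rw [map_add, map_add, hp, hq, AddMonoidAlgebra.coeff_add,
        Finsupp.sum_add_index (by simp) (by simp)]
  have hf0 : toSemigroupAlgebra k a f = 0 := hf
  rw [← Ideal.Quotient.eq_zero_iff_mem, key, hf0]
  simp

/-- Allowing `β = 0` includes the fact that no nonzero monomial lies in the ideal. -/
theorem monomial_sub_mem_semigroupIdeal_iff {u v : Fin r →₀ ℕ} {α β : k} (hα : α ≠ 0) :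
    monomial u α - monomial v β ∈ semigroupIdeal k a ↔
      Finsupp.weight (gen a) u = Finsupp.weight (gen a) v ∧ α = β := by
  rw [semigroupIdeal, RingHom.mem_ker, map_sub, toSemigroupAlgebra_monomial,
    toSemigroupAlgebra_monomial, sub_eq_zero]
  constructor
  · intro h
    rcases AddMonoidAlgebra.single_inj.1 h with h | h
    · exact h
    · exact absurd h.1 hα
  · rintro ⟨h, rfl⟩
    rw [h]

theorem hasDegree_monomial_sub {u v : Fin r →₀ ℕ} {α β : k}
    (h : Finsupp.weight (gen a) u = Finsupp.weight (gen a) v) :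
    HasDegree a (monomial u α - monomial v β) (Finsupp.weight (gen a) u) := by
  rw [HasDegree, ← mem_weightedHomogeneousSubmodule]
  refine Submodule.sub_mem _ ?_ ?_
  · exact isWeightedHomogeneous_monomial _ _ _ rfl
  · exact isWeightedHomogeneous_monomial _ _ _ h.symm

theorem IsBinomialSystem.isHomogeneousSystem {S : Set (MvPolynomial (Fin r) k)}
    (hS : IsBinomialSystem a S) : IsHomogeneousSystem a S := by
  refine ⟨fun f hf => ?_, hS.2⟩
  obtain ⟨u, v, α, β, -, hα, -, rfl⟩ := hS.1 f hf
  have hmem := hS.2 ▸ Ideal.subset_span hf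
  exact ⟨_, hasDegree_monomial_sub ((monomial_sub_mem_semigroupIdeal_iff hα).1 hmem).1⟩

/-- A homogeneous element of the semigroup ideal whose degree has a fiber contained in `{u, v}` is
a multiple of the difference of the two monomials. -/
theorem HasDegree.eq_C_mul_of_fiber_subset {f : MvPolynomial (Fin r) k} {d : semigroup a}
    (hf : HasDegree a f d) (hI : f ∈ semigroupIdeal k a) {u v : Fin r →₀ ℕ}
    (hd : ∀ w, Finsupp.weight (gen a) w = d → w = u ∨ w = v) :
    ∃ c, f = C c * (monomial u 1 - monomial v 1) := by
  classical
  -- The case of a singleton fiber, where `f` must vanish.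
  by_cases huv : u = v
  · subst huv
    have h : f = monomial u (coeff u f) - monomial u 0 := by
      ext w
      by_cases hw : coeff w f = 0
      · by_cases h' : u = w
        · subst h'; simp
        · simp [hw, h']
      · have := hd w (hf hw)
        simp_all
    refine ⟨0, ?_⟩
    by_cases h0 : coeff u f = 0
    · rw [h, h0]; simp
    · rw [h] at hI
      exact absurd ((monomial_sub_mem_semigroupIdeal_iff h0).1 hI).2 h0
  · have h : f = monomial u (coeff u f) - monomial v (-coeff v f) := by
      ext w
      by_cases hw : coeff w f = 0
      · by_cases h' : u = w
        · subst h'; simp [Ne.symm huv]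
        · by_cases h'' : v = w
          · subst h''; simp [h']
          · simp [hw, h', h'']
      · rcases hd w (hf hw) with rfl | rfl
        · simp [Ne.symm huv]
        · simp [huv]
    refine ⟨coeff u f, ?_⟩
    by_cases h0 : coeff u f = 0
    · rw [h0] at h
      by_cases h1 : coeff v f = 0
      · refine h.trans ?_
        rw [h0, h1]; simp
      · have h2 : monomial v (coeff v f) - monomial u 0 ∈ semigroupIdeal k a := by
          convert hI using 1
          conv_rhs => rw [h]
          simp
        exact absurd ((monomial_sub_mem_semigroupIdeal_iff h1).1 h2).2 h1
    · have hI' := hI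
      rw [h] at hI'
      have h1 := ((monomial_sub_mem_semigroupIdeal_iff h0).1 hI').2
      rw [← h1] at h
      conv_lhs => rw [h]
      rw [mul_sub, C_mul_monomial, C_mul_monomial, mul_one]

/-- Every monomial of an element of an ideal is divisible by a monomial of a generator. -/
theorem exists_coeff_ne_zero_of_mem_span {σ R : Type*} [CommSemiring R]
    {S : Set (MvPolynomial σ R)} {f : MvPolynomial σ R} (hf : f ∈ Ideal.span S) {m : σ →₀ ℕ}
    (hm : coeff m f ≠ 0) : ∃ s ∈ S, ∃ u ≤ m, coeff u s ≠ 0 := by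
  classical
  by_contra! H
  -- Vanishing at all divisors of `m`, unlike vanishing at `m` alone, survives multiplication by a
  -- polynomial.
  suffices h : ∀ u ≤ m, coeff u f = 0 from hm (h m le_rfl)
  clear hm
  induction hf using Submodule.span_induction with
  | mem s hs => exact H s hs
  | zero => simp
  | add p q _ _ hp hq =>
    intro u hu
    rw [coeff_add, hp u hu, hq u hu, add_zero]
  | smul p q _ hq =>
    intro u hu
    rw [smul_eq_mul, coeff_mul]
    refine Finset.sum_eq_zero fun x hx => ?_
    have hx' : x.1 + x.2 = u := Finset.HasAntidiagonal.mem_antidiagonal.1 hx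
    have hle : x.2 ≤ u := hx' ▸ le_add_self
    rw [hq _ (hle.trans hu), mul_zero]

/-- If the fiber of `u` is `{u, v}` and the fibers of the proper divisors of `u` are singletons,
every system of homogeneous generators contains a nonzero multiple of `X^u - X^v`. -/
theorem IsHomogeneousSystem.exists_C_mul_mem {S : Set (MvPolynomial (Fin r) k)}
    (hS : IsHomogeneousSystem a S) {u v : Fin r →₀ ℕ} (huv : u ≠ v)
    (hw : Finsupp.weight (gen a) u = Finsupp.weight (gen a) v)
    (hfib : ∀ w, Finsupp.weight (gen a) w = Finsupp.weight (gen a) u → w = u ∨ w = v)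
    (hdiv : ∀ t ≤ u, t ≠ u → ∀ w, Finsupp.weight (gen a) w = Finsupp.weight (gen a) t → w = t) :
    ∃ c : k, c ≠ 0 ∧ C c * (monomial u 1 - monomial v 1) ∈ S := by
  classical
  have hmem : monomial u (1 : k) - monomial v 1 ∈ Ideal.span S := by
    rw [hS.2]
    exact (monomial_sub_mem_semigroupIdeal_iff one_ne_zero).2 ⟨hw, rfl⟩
  obtain ⟨s, hs, t, ht, hts⟩ := exists_coeff_ne_zero_of_mem_span (m := u) hmem
    (by simp [Ne.symm huv])
  obtain ⟨d, hd⟩ := hS.1 s hs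
  have hsI : s ∈ semigroupIdeal k a := hS.2 ▸ Ideal.subset_span hs
  have htd := hd hts
  by_cases htu : t = u
  · subst htu
    obtain ⟨c, rfl⟩ := hd.eq_C_mul_of_fiber_subset hsI (fun w h => hfib w (h.trans htd.symm))
    refine ⟨c, ?_, hs⟩
    rintro rfl
    simp at hts
  -- The fiber of `t` is a singleton, so `s` would be a multiple of `X^t - X^t = 0`.
  · obtain ⟨c, rfl⟩ := hd.eq_C_mul_of_fiber_subset hsI (u := t) (v := t)
      (fun w h => Or.inl (hdiv t ht htu w (h.trans htd.symm)))
    simp at hts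

end General

/-! ### Block structure of the matrix and the relevant fibers. -/

section Example

/-- The smallest variable of each of the four blocks `{b, b + 2, b + 8, b + 10}`. -/
def blockBase : Fin 4 → Fin 16 := ![0, 1, 4, 5]

theorem exists_eq_blockBase_add (j : Fin 16) : ∃ i, j = blockBase i ∨ j = blockBase i + 10 ∨
    j = blockBase i + 2 ∨ j = blockBase i + 8 := by
  revert j
  decide

/-- The leading exponents of the four binomials. -/
noncomputable def posExponent (i : Fin 4) : Fin 16 →₀ ℕ :=
  Finsupp.single (blockBase i) 1 + Finsupp.single (blockBase i + 10) 1

/-- The trailing exponents of the four binomials. -/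
noncomputable def negExponent (i : Fin 4) : Fin 16 →₀ ℕ :=
  Finsupp.single (blockBase i + 2) 1 + Finsupp.single (blockBase i + 8) 1

theorem exampleBinomial_eq (k : Type*) [Field k] (i : Fin 4) :
    exampleBinomial k i = monomial (posExponent i) 1 - monomial (negExponent i) 1 := by
  have h : ∀ p q : Fin 16, (X p * X q : MvPolynomial (Fin 16) k) =
      monomial (Finsupp.single p 1 + Finsupp.single q 1) 1 := fun p q => by
    rw [X, X, monomial_mul, one_mul]
  rw [posExponent, negExponent, ← h, ← h]
  fin_cases i <;> rfl

/-- For each row, the first column with entry `1`. -/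
def firstColumn : Fin 16 → Fin 16 := ![0, 1, 2, 3, 4, 5, 6, 7, 0, 1, 4, 5, 8, 9, 12, 13]

/-- For each row, the second column with entry `1`. -/
def secondColumn : Fin 16 → Fin 16 := ![8, 9, 10, 11, 12, 13, 14, 15, 2, 3, 6, 7, 10, 11, 14, 15]

theorem exampleColumns_apply : ∀ p j : Fin 16, exampleColumns j p =
    (if j = firstColumn p then 1 else 0) + (if j = secondColumn p then 1 else 0) := by
  decide

theorem weight_exampleColumns_eq_iff {u v : Fin 16 →₀ ℕ} :
    Finsupp.weight (gen exampleColumns) u = Finsupp.weight (gen exampleColumns) v ↔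
      ∀ p, u (firstColumn p) + u (secondColumn p) = v (firstColumn p) + v (secondColumn p) := by
  have h (w : Fin 16 →₀ ℕ) (p : Fin 16) : ((Finsupp.weight (gen exampleColumns) w :
      semigroup exampleColumns) : Fin 16 → ℕ) p = w (firstColumn p) + w (secondColumn p) := by
    rw [coe_weight_gen, Finset.sum_apply]
    have : ∀ j, (w j • exampleColumns j) p = w j * exampleColumns j p := fun j => rfl
    simp only [this, exampleColumns_apply, mul_add, Finset.sum_add_distrib]
    simp
  rw [← Subtype.coe_inj, _root_.funext_iff]
  simp only [h]

theorem weight_exampleColumns_eq_iff_block {u v : Fin 16 →₀ ℕ} :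
    Finsupp.weight (gen exampleColumns) u = Finsupp.weight (gen exampleColumns) v ↔
      ∀ i, u (blockBase i) + u (blockBase i + 2) = v (blockBase i) + v (blockBase i + 2) ∧
        u (blockBase i) + u (blockBase i + 8) = v (blockBase i) + v (blockBase i + 8) ∧
        u (blockBase i + 2) + u (blockBase i + 10) =
          v (blockBase i + 2) + v (blockBase i + 10) ∧
        u (blockBase i + 8) + u (blockBase i + 10) =
          v (blockBase i + 8) + v (blockBase i + 10) := by
  rw [weight_exampleColumns_eq_iff]
  have hb : ∀ i : Fin 4,
      (∃ p, firstColumn p = blockBase i ∧ secondColumn p = blockBase i + 2) ∧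
      (∃ p, firstColumn p = blockBase i ∧ secondColumn p = blockBase i + 8) ∧
      (∃ p, firstColumn p = blockBase i + 2 ∧ secondColumn p = blockBase i + 10) ∧
      (∃ p, firstColumn p = blockBase i + 8 ∧ secondColumn p = blockBase i + 10) := by
    decide
  have hp : ∀ p : Fin 16, ∃ i : Fin 4,
      (firstColumn p = blockBase i ∧ secondColumn p = blockBase i + 2) ∨
      (firstColumn p = blockBase i ∧ secondColumn p = blockBase i + 8) ∨
      (firstColumn p = blockBase i + 2 ∧ secondColumn p = blockBase i + 10) ∨
      (firstColumn p = blockBase i + 8 ∧ secondColumn p = blockBase i + 10) := by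
    decide
  constructor
  · intro h i
    obtain ⟨⟨p, hp⟩, ⟨q, hq⟩, ⟨s, hs⟩, ⟨t, ht⟩⟩ := hb i
    have h1 := h p
    have h2 := h q
    have h3 := h s
    have h4 := h t
    rw [hp.1, hp.2] at h1
    rw [hq.1, hq.2] at h2
    rw [hs.1, hs.2] at h3
    rw [ht.1, ht.2] at h4
    exact ⟨h1, h2, h3, h4⟩
  · intro h p
    obtain ⟨i, hi⟩ := hp p
    obtain ⟨h1, h2, h3, h4⟩ := h i
    rcases hi with hi | hi | hi | hi <;> rw [hi.1, hi.2] <;> assumption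

theorem ext_block {u v : Fin 16 →₀ ℕ} (h : ∀ i, u (blockBase i) = v (blockBase i) ∧
    u (blockBase i + 10) = v (blockBase i + 10) ∧ u (blockBase i + 2) = v (blockBase i + 2) ∧
    u (blockBase i + 8) = v (blockBase i + 8)) : u = v := by
  ext j
  obtain ⟨i, hi⟩ := exists_eq_blockBase_add j
  obtain ⟨h1, h2, h3, h4⟩ := h i
  rcases hi with rfl | rfl | rfl | rfl <;> assumption

theorem posExponent_apply_block (i j : Fin 4) :
    posExponent i (blockBase j) = (if i = j then 1 else 0) ∧
    posExponent i (blockBase j + 10) = (if i = j then 1 else 0) ∧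
    posExponent i (blockBase j + 2) = 0 ∧ posExponent i (blockBase j + 8) = 0 := by
  simp only [posExponent, Finsupp.add_apply, Finsupp.single_apply]
  revert i j
  decide

theorem negExponent_apply_block (i j : Fin 4) :
    negExponent i (blockBase j) = 0 ∧ negExponent i (blockBase j + 10) = 0 ∧
    negExponent i (blockBase j + 2) = (if i = j then 1 else 0) ∧
    negExponent i (blockBase j + 8) = (if i = j then 1 else 0) := by
  simp only [negExponent, Finsupp.add_apply, Finsupp.single_apply]
  revert i j
  decide

theorem posExponent_ne_negExponent (i j : Fin 4) : posExponent i ≠ negExponent j := by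
  intro h
  have h1 := (posExponent_apply_block i i).1
  rw [h, (negExponent_apply_block j i).1] at h1
  simp at h1

theorem posExponent_injective : Function.Injective posExponent := by
  intro i j h
  have h1 := (posExponent_apply_block i i).1
  rw [h, (posExponent_apply_block j i).1] at h1
  by_contra hij
  simp [Ne.symm hij] at h1

theorem weight_posExponent (i : Fin 4) :
    Finsupp.weight (gen exampleColumns) (posExponent i) =
      Finsupp.weight (gen exampleColumns) (negExponent i) := by
  rw [weight_exampleColumns_eq_iff_block]
  intro j
  obtain ⟨h1, h2, h3, h4⟩ := posExponent_apply_block i j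
  obtain ⟨h1', h2', h3', h4'⟩ := negExponent_apply_block i j
  omega

theorem eq_posExponent_or_eq_negExponent {i : Fin 4} {w : Fin 16 →₀ ℕ}
    (h : Finsupp.weight (gen exampleColumns) w =
      Finsupp.weight (gen exampleColumns) (posExponent i)) :
    w = posExponent i ∨ w = negExponent i := by
  rw [weight_exampleColumns_eq_iff_block] at h
  have hi := h i
  obtain ⟨h1, h2, h3, h4⟩ := posExponent_apply_block i i
  rw [if_pos rfl] at h1 h2
  -- Block `i` has all margins 1, so its corner entry is 0 or 1 and determines the rest; the other
  -- blocks have zero margins.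
  by_cases h0 : w (blockBase i) = 0
  · right
    refine ext_block fun j => ?_
    have hj := h j
    obtain ⟨h1, h2, h3, h4⟩ := posExponent_apply_block i j
    obtain ⟨h1', h2', h3', h4'⟩ := negExponent_apply_block i j
    by_cases hij : i = j
    · subst hij
      simp only [if_true] at *
      omega
    · simp only [hij, if_false] at *
      omega
  · left
    refine ext_block fun j => ?_
    have hj := h j
    obtain ⟨h1, h2, h3, h4⟩ := posExponent_apply_block i j
    by_cases hij : i = j
    · subst hij
      omega
    · simp only [hij, if_false] at *
      omega

theorem eq_of_weight_eq_of_lt_posExponent {i : Fin 4} {t w : Fin 16 →₀ ℕ} (ht : t ≤ posExponent i)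
    (hne : t ≠ posExponent i)
    (h : Finsupp.weight (gen exampleColumns) w = Finsupp.weight (gen exampleColumns) t) :
    w = t := by
  rw [weight_exampleColumns_eq_iff_block] at h
  -- A proper divisor misses a diagonal entry of block `i`. One row sum and one column sum then
  -- vanish, which forces the whole table.
  have hz : t (blockBase i) = 0 ∨ t (blockBase i + 10) = 0 := by
    by_contra! hc
    refine hne (ext_block fun j => ?_)
    obtain ⟨h1, h2, h3, h4⟩ := posExponent_apply_block i j
    have l1 := ht (blockBase j)
    have l2 := ht (blockBase j + 10)
    have l3 := ht (blockBase j + 2)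
    have l4 := ht (blockBase j + 8)
    by_cases hij : i = j
    · subst hij
      simp only [if_true] at *
      omega
    · simp only [hij, if_false] at *
      omega
  refine ext_block fun j => ?_
  have hj := h j
  obtain ⟨h1, h2, h3, h4⟩ := posExponent_apply_block i j
  have l1 := ht (blockBase j)
  have l2 := ht (blockBase j + 10)
  have l3 := ht (blockBase j + 2)
  have l4 := ht (blockBase j + 8)
  by_cases hij : i = j
  · subst hij
    simp only [if_true] at *
    omega
  · simp only [hij, if_false] at *
    omega

/-- The tables differ by `d` on the diagonal and `-d` off it, so `d` uses of `h` suffice. Three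
margins determine the fourth. -/
theorem pow_mul_pow_eq_of_mul_eq {R : Type*} [CommMonoid R] {x y z t : R} (h : x * y = z * t)
    {m₁ m₂ m₃ m₄ n₁ n₂ n₃ n₄ : ℕ} (h₁ : m₁ + m₃ = n₁ + n₃) (h₂ : m₁ + m₄ = n₁ + n₄)
    (h₃ : m₃ + m₂ = n₃ + n₂) :
    x ^ m₁ * y ^ m₂ * (z ^ m₃ * t ^ m₄) = x ^ n₁ * y ^ n₂ * (z ^ n₃ * t ^ n₄) := by
  wlog hle : m₁ ≤ n₁ generalizing m₁ m₂ m₃ m₄ n₁ n₂ n₃ n₄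
  · exact (this h₁.symm h₂.symm h₃.symm (le_of_not_ge hle)).symm
  obtain ⟨d, rfl⟩ := Nat.exists_eq_add_of_le hle
  obtain rfl : n₂ = m₂ + d := by omega
  obtain rfl : m₃ = n₃ + d := by omega
  obtain rfl : m₄ = n₄ + d := by omega
  have hd : x ^ d * y ^ d = z ^ d * t ^ d := by rw [← mul_pow, h, mul_pow]
  calc x ^ m₁ * y ^ m₂ * (z ^ (n₃ + d) * t ^ (n₄ + d))
      = x ^ m₁ * y ^ m₂ * (z ^ n₃ * t ^ n₄) * (z ^ d * t ^ d) := by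
        simp only [pow_add]; ac_rfl
    _ = x ^ (m₁ + d) * y ^ (m₂ + d) * (z ^ n₃ * t ^ n₄) := by
        rw [← hd]; simp only [pow_add]; ac_rfl

theorem prod_univ_eq_prod_block {R : Type*} [CommMonoid R] (f : Fin 16 → R) :
    ∏ j, f j = ∏ i, (f (blockBase i) * f (blockBase i + 10) *
      (f (blockBase i + 2) * f (blockBase i + 8))) := by
  have h4 : ∀ g : Fin 4 → R, ∏ i, g i = g 0 * g 1 * g 2 * g 3 := Fin.prod_univ_four
  have h16 : ∏ j, f j = f 0 * f 1 * f 2 * f 3 * f 4 * f 5 * f 6 * f 7 * f 8 * f 9 * f 10 *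
      f 11 * f 12 * f 13 * f 14 * f 15 := by
    simp only [Fin.prod_univ_castSucc, Fin.prod_univ_zero, one_mul]
    rfl
  rw [h4, h16]
  change _ = (f 0 * f 10 * (f 2 * f 8)) * (f 1 * f 11 * (f 3 * f 9)) *
    (f 4 * f 14 * (f 6 * f 12)) * (f 5 * f 15 * (f 7 * f 13))
  ac_rfl

/-! ### Generation, minimal systems and indispensability. -/

variable {k : Type*} [Field k]

theorem span_range_exampleBinomial : Ideal.span (Set.range (exampleBinomial k)) =
    semigroupIdeal k exampleColumns := by
  apply le_antisymm
  · rw [Ideal.span_le]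
    rintro _ ⟨i, rfl⟩
    rw [exampleBinomial_eq]
    exact (monomial_sub_mem_semigroupIdeal_iff one_ne_zero).2 ⟨weight_posExponent i, rfl⟩
  · apply semigroupIdeal_le_of_monomial_sub_mem
    intro u v huv
    rw [weight_exampleColumns_eq_iff_block] at huv
    have hmon : ∀ w : Fin 16 →₀ ℕ, (monomial w 1 : MvPolynomial (Fin 16) k) = ∏ j, X j ^ w j := by
      intro w
      rw [monomial_eq, C_1, one_mul, Finsupp.prod_fintype _ _ (fun j => pow_zero _)]
    rw [hmon, hmon, map_prod, map_prod, prod_univ_eq_prod_block, prod_univ_eq_prod_block]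
    refine Finset.prod_congr rfl fun i _ => ?_
    obtain ⟨h1, h2, h3, -⟩ := huv i
    simp only [map_pow]
    refine pow_mul_pow_eq_of_mul_eq ?_ h1 h2 h3
    rw [← map_mul, ← map_mul, Ideal.Quotient.eq]
    refine Ideal.subset_span ⟨i, ?_⟩
    rw [exampleBinomial_eq, posExponent, negExponent]
    simp only [X, monomial_mul, one_mul]

theorem C_mul_exampleBinomial (i : Fin 4) (c : k) : C c * exampleBinomial k i =
    monomial (posExponent i) c - monomial (negExponent i) c := by
  rw [exampleBinomial_eq, mul_sub, C_mul_monomial, C_mul_monomial, mul_one]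

theorem isBinomial_C_mul_exampleBinomial (i : Fin 4) {c : k} (hc : c ≠ 0) :
    IsBinomial (C c * exampleBinomial k i) :=
  ⟨_, _, c, c, posExponent_ne_negExponent i i, hc, hc, C_mul_exampleBinomial i c⟩

theorem hasDegree_C_mul_exampleBinomial (i : Fin 4) (c : k) :
    HasDegree exampleColumns (C c * exampleBinomial k i)
      (Finsupp.weight (gen exampleColumns) (posExponent i)) := by
  rw [C_mul_exampleBinomial]
  exact hasDegree_monomial_sub (weight_posExponent i)

theorem coeff_posExponent_C_mul_exampleBinomial (i j : Fin 4) (c : k) :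
    coeff (posExponent i) (C c * exampleBinomial k j) = if j = i then c else 0 := by
  rw [C_mul_exampleBinomial, coeff_sub, coeff_monomial, coeff_monomial,
    if_neg (posExponent_ne_negExponent i j).symm, sub_zero]
  simp only [posExponent_injective.eq_iff]

theorem eq_of_C_mul_exampleBinomial_eq {i j : Fin 4} {c c' : k} (hc : c ≠ 0)
    (h : C c * exampleBinomial k i = C c' * exampleBinomial k j) : i = j := by
  have h1 := congrArg (coeff (posExponent i)) h
  rw [coeff_posExponent_C_mul_exampleBinomial, coeff_posExponent_C_mul_exampleBinomial,
    if_pos rfl] at h1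
  by_contra hij
  rw [if_neg (Ne.symm hij)] at h1
  exact hc h1

theorem IsHomogeneousSystem.exists_C_mul_exampleBinomial_mem
    {S : Set (MvPolynomial (Fin 16) k)} (hS : IsHomogeneousSystem exampleColumns S) (i : Fin 4) :
    ∃ c : k, c ≠ 0 ∧ C c * exampleBinomial k i ∈ S := by
  rw [exampleBinomial_eq]
  exact hS.exists_C_mul_mem (posExponent_ne_negExponent i i) (weight_posExponent i)
    (fun _ => eq_posExponent_or_eq_negExponent)
    (fun _ ht hne _ => eq_of_weight_eq_of_lt_posExponent ht hne)

theorem isBinomialSystem_range_C_mul_exampleBinomial {c : Fin 4 → k} (hc : ∀ i, c i ≠ 0) :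
    IsBinomialSystem exampleColumns (Set.range fun i => C (c i) * exampleBinomial k i) := by
  constructor
  · rintro _ ⟨i, rfl⟩
    exact isBinomial_C_mul_exampleBinomial i (hc i)
  · rw [← span_range_exampleBinomial]
    apply le_antisymm <;> rw [Ideal.span_le] <;> rintro _ ⟨i, rfl⟩
    · exact Ideal.mul_mem_left _ _ (Ideal.subset_span ⟨i, rfl⟩)
    · have h : exampleBinomial k i = C (c i)⁻¹ * (C (c i) * exampleBinomial k i) := by
        rw [← mul_assoc, ← C_mul, inv_mul_cancel₀ (hc i), C_1, one_mul]
      rw [SetLike.mem_coe, h]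
      exact Ideal.mul_mem_left _ _ (Ideal.subset_span ⟨i, rfl⟩)

/-- Any notion of system between binomial and homogeneous systems has the same minimal systems. -/
theorem minimal_system_iff {P : Set (MvPolynomial (Fin 16) k) → Prop}
    (hP : ∀ S, IsBinomialSystem exampleColumns S → P S)
    (hP' : ∀ S, P S → IsHomogeneousSystem exampleColumns S) (S : Set (MvPolynomial (Fin 16) k)) :
    Minimal P S ↔ ∃ c : Fin 4 → k, (∀ i, c i ≠ 0) ∧
      S = Set.range fun i => C (c i) * exampleBinomial k i := by
  constructor
  · intro hS
    choose c hc hmem using (hP' S hS.1).exists_C_mul_exampleBinomial_mem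
    exact ⟨c, hc, hS.eq_of_subset (hP _ (isBinomialSystem_range_C_mul_exampleBinomial hc))
      (Set.range_subset_iff.2 hmem) |>.symm⟩
  · rintro ⟨c, hc, rfl⟩
    refine ⟨hP _ (isBinomialSystem_range_C_mul_exampleBinomial hc), fun T hT hle => ?_⟩
    rintro _ ⟨i, rfl⟩
    obtain ⟨c', hc', hmem⟩ := (hP' T hT).exists_C_mul_exampleBinomial_mem i
    -- The multiple in `T` is one of the listed elements, and the index must agree since different
    -- binomials are not proportional.
    obtain ⟨j, hj⟩ := hle hmem
    obtain rfl := eq_of_C_mul_exampleBinomial_eq (hc j) hj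
    change C (c j) * exampleBinomial k j ∈ T
    rwa [show C (c j) * exampleBinomial k j = _ from hj]

theorem isIndispensableDegree_posExponent (i : Fin 4) :
    IsIndispensableDegree k exampleColumns
      (Finsupp.weight (gen exampleColumns) (posExponent i)) := by
  intro S hS
  obtain ⟨c, hc, rfl⟩ := (minimal_system_iff (fun _ => IsBinomialSystem.isHomogeneousSystem)
    (fun _ => id) S).1 hS
  refine ⟨C (c i) * exampleBinomial k i, ⟨⟨i, rfl⟩, hasDegree_C_mul_exampleBinomial i _⟩, ?_⟩
  rintro _ ⟨⟨j, rfl⟩, hj⟩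
  have hcoeff : coeff (posExponent j) (C (c j) * exampleBinomial k j) ≠ 0 := by
    rw [coeff_posExponent_C_mul_exampleBinomial, if_pos rfl]
    exact hc j
  rcases eq_posExponent_or_eq_negExponent (hj hcoeff) with h | h
  · rw [posExponent_injective h]
  · exact absurd h (posExponent_ne_negExponent j i)

theorem isIndispensableBinomial_exampleColumns_iff (f : MvPolynomial (Fin 16) k) :
    IsIndispensableBinomial exampleColumns f ↔
      ∃ (i : Fin 4) (c : k), c ≠ 0 ∧ f = C c * exampleBinomial k i := by
  have hmin := minimal_system_iff (k := k) (fun _ => IsBinomialSystem.isHomogeneousSystem)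
    (fun _ => id)
  constructor
  · rintro ⟨d, -, -, S, hS, hf⟩
    obtain ⟨c, hc, rfl⟩ := (hmin S).1 hS
    obtain ⟨i, rfl⟩ := hf
    exact ⟨i, c i, hc i, rfl⟩
  · rintro ⟨i, c, hc, rfl⟩
    exact ⟨_, isIndispensableDegree_posExponent i, hasDegree_C_mul_exampleBinomial i c, _,
      (hmin _).2 ⟨fun _ => c, fun _ => hc, rfl⟩, i, rfl⟩

theorem isInEveryBinomialSystem_exampleColumns_iff (f : MvPolynomial (Fin 16) k) :
    IsInEveryBinomialSystem exampleColumns f ↔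
      ∃ (i : Fin 4) (c : k), c ≠ 0 ∧ f = C c * exampleBinomial k i := by
  constructor
  · rintro ⟨-, hf⟩
    -- It is enough to test `f` against the system of the four binomials themselves.
    obtain ⟨c, hc, i, hi⟩ := hf _ (isBinomialSystem_range_C_mul_exampleBinomial
      (c := fun _ => (1 : k)) (fun _ => one_ne_zero))
    refine ⟨i, c⁻¹, inv_ne_zero hc, ?_⟩
    simp only [C_1, one_mul] at hi
    rw [hi, ← mul_assoc, ← C_mul, inv_mul_cancel₀ hc, C_1, one_mul]
  · rintro ⟨i, c, hc, rfl⟩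
    refine ⟨isBinomial_C_mul_exampleBinomial i hc, fun S hS => ?_⟩
    obtain ⟨c', hc', hmem⟩ := hS.isHomogeneousSystem.exists_C_mul_exampleBinomial_mem i
    refine ⟨c' * c⁻¹, mul_ne_zero hc' (inv_ne_zero hc), ?_⟩
    rwa [← mul_assoc, ← C_mul, mul_assoc, inv_mul_cancel₀ hc, mul_one]

/-! ### Maximal cliques of the graph and the labelling of the rows. -/

instance : DecidableRel exampleGraph.Adj := fun u v =>
  decidable_of_iff (u ≠ v ∧ s(u, v) ∈ ({s(0, 1), s(1, 2), s(2, 3), s(3, 0), s(1, 3)} :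
    Finset (Sym2 (Fin 4)))) (by simp [exampleGraph, and_comm])

/-- The clique of the vertices that each row of the matrix refers to. -/
def rowClique (p : Fin 16) : Finset (Fin 4) := if p < 8 then {1, 2, 3} else {0, 1, 3}

theorem maximal_isClique_exampleGraph_iff (K : Finset (Fin 4)) :
    Maximal (fun s : Finset (Fin 4) => exampleGraph.IsClique s) K ↔
      K = {1, 2, 3} ∨ K = {0, 1, 3} := by
  -- The only non-adjacent pair of distinct vertices is `0, 2`.
  have h : ∀ s : Finset (Fin 4), exampleGraph.IsClique s ↔ ¬ (0 ∈ s ∧ 2 ∈ s) := by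
    intro s
    have : exampleGraph.IsClique s ↔
        ∀ x ∈ s, ∀ y ∈ s, x ≠ y → exampleGraph.Adj x y := Iff.rfl
    rw [this]
    revert s
    decide
  simp only [Maximal, h]
  revert K
  decide

theorem maximal_isClique_rowClique (p : Fin 16) :
    Maximal (fun s : Finset (Fin 4) => exampleGraph.IsClique s) (rowClique p) := by
  rw [maximal_isClique_exampleGraph_iff]
  revert p
  decide

/-- The pair of a maximal clique and a joint state of its vertices that labels a row. -/
def rowLabel (p : Fin 16) : Σ K : {K : Finset (Fin 4) //
    Maximal (fun s : Finset (Fin 4) => exampleGraph.IsClique s) K}, K.1 → Fin 2 :=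
  ⟨⟨rowClique p, maximal_isClique_rowClique p⟩, fun v => state (firstColumn p) v⟩

theorem rowLabel_injective : Function.Injective rowLabel := by
  have key : ∀ p q : Fin 16, rowClique p = rowClique q →
      (∀ v ∈ rowClique p, state (firstColumn p) v = state (firstColumn q) v) → p = q := by
    decide
  -- Compares dependent pairs pointwise, avoiding heterogeneous equality and leaving a finite check.
  have aux : ∀ (x y : Σ K : {K : Finset (Fin 4) //
      Maximal (fun s : Finset (Fin 4) => exampleGraph.IsClique s) K}, K.1 → Fin 2), x = y →
      x.1.1 = y.1.1 ∧ ∀ v (hx : v ∈ x.1.1) (hy : v ∈ y.1.1), x.2 ⟨v, hx⟩ = y.2 ⟨v, hy⟩ := by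
    rintro x _ rfl
    exact ⟨rfl, fun _ _ _ => rfl⟩
  intro p q h
  obtain ⟨h1, h2⟩ := aux _ _ h
  have h1' : rowClique p = rowClique q := h1
  exact key p q h1' fun v hv => h2 v hv (h1.subset hv)

theorem rowLabel_surjective : Function.Surjective rowLabel := by
  have key : ∀ q : Fin 16, ∀ y : Fin 4 → Fin 2, ∃ p, rowClique p = rowClique q ∧
      ∀ v ∈ rowClique p, state (firstColumn p) v = y v := by
    decide
  have hK : ∀ K : Finset (Fin 4), K = {1, 2, 3} ∨ K = {0, 1, 3} → ∃ q, rowClique q = K := by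
    rintro K (rfl | rfl)
    exacts [⟨0, rfl⟩, ⟨8, rfl⟩]
  rintro ⟨⟨K, hmax⟩, x⟩
  obtain ⟨q, rfl⟩ := hK K ((maximal_isClique_exampleGraph_iff K).1 hmax)
  -- `x` is extended to all vertices so that `key` applies; the value 0 off the clique is
  -- irrelevant.
  obtain ⟨p, hp, hx⟩ := key q fun v => if hv : v ∈ rowClique q then x ⟨v, hv⟩ else 0
  refine ⟨p, ?_⟩
  have aux : ∀ (L : Finset (Fin 4))
      (hL : Maximal (fun s : Finset (Fin 4) => exampleGraph.IsClique s) L)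
      (y : L → Fin 2), L = rowClique q →
      (∀ v (h : v ∈ L) (h' : v ∈ rowClique q), y ⟨v, h⟩ = x ⟨v, h'⟩) →
      (⟨⟨L, hL⟩, y⟩ : Σ K : {K : Finset (Fin 4) //
        Maximal (fun s : Finset (Fin 4) => exampleGraph.IsClique s) K}, K.1 → Fin 2) =
        ⟨⟨rowClique q, hmax⟩, x⟩ := by
    rintro L hL y rfl hy
    obtain rfl : y = x := funext fun v => hy v.1 v.2 v.2
    rfl
  refine aux _ _ _ hp fun v hv hv' => ?_
  have := hx v hv
  rwa [dif_pos hv'] at this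

theorem exampleMatrix_eq_submatrix_rowLabel (p j : Fin 16) :
    exampleMatrix p j = cliqueMarginalMatrix exampleGraph (rowLabel p) (state j) := by
  have key : ∀ p j : Fin 16, exampleColumns j p =
      if ∀ v ∈ rowClique p, state j v = state (firstColumn p) v then 1 else 0 := by
    decide
  refine (key p j).trans ?_
  rw [cliqueMarginalMatrix]
  refine if_congr ?_ rfl rfl
  rw [_root_.funext_iff, Subtype.forall]
  rfl

end Example

end SemigroupIdeal

theorem mainTheorem9 (k : Type*) [Field k] :
    -- the matrix is the matrix of the binary model of the graph
    (∃ e : Fin 16 ≃ Σ K : {K : Finset (Fin 4) //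
          Maximal (fun s : Finset (Fin 4) => SemigroupIdeal.exampleGraph.IsClique s) K},
          K.1 → Fin 2,
      SemigroupIdeal.exampleMatrix =
        (SemigroupIdeal.cliqueMarginalMatrix SemigroupIdeal.exampleGraph).submatrix
          e SemigroupIdeal.state) ∧
    -- up to nonzero scalars, the indispensable binomials are the four given ones
    (∀ f : MvPolynomial (Fin 16) k,
      SemigroupIdeal.IsIndispensableBinomial SemigroupIdeal.exampleColumns f ↔
        ∃ (i : Fin 4) (c : k), c ≠ 0 ∧ f = C c * SemigroupIdeal.exampleBinomial k i) ∧
    (∀ f : MvPolynomial (Fin 16) k,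
      SemigroupIdeal.IsInEveryBinomialSystem SemigroupIdeal.exampleColumns f ↔
        ∃ (i : Fin 4) (c : k), c ≠ 0 ∧ f = C c * SemigroupIdeal.exampleBinomial k i) ∧
    -- no two of the four are scalar multiples of each other
    (∀ (i j : Fin 4) (c : k),
      SemigroupIdeal.exampleBinomial k i = C c * SemigroupIdeal.exampleBinomial k j → i = j) ∧
    -- they generate the ideal
    Ideal.span (Set.range (SemigroupIdeal.exampleBinomial k)) =
      SemigroupIdeal.semigroupIdeal k SemigroupIdeal.exampleColumns ∧
    -- up to nonzero scalars, they form the unique minimal system of binomial generators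
    (∀ S : Set (MvPolynomial (Fin 16) k),
      Minimal (SemigroupIdeal.IsBinomialSystem SemigroupIdeal.exampleColumns) S ↔
        ∃ c : Fin 4 → k, (∀ i, c i ≠ 0) ∧
          S = Set.range fun i => C (c i) * SemigroupIdeal.exampleBinomial k i) := by
  open SemigroupIdeal in exact ⟨⟨Equiv.ofBijective rowLabel ⟨rowLabel_injective, rowLabel_surjective⟩,
      Matrix.ext exampleMatrix_eq_submatrix_rowLabel⟩,
    isIndispensableBinomial_exampleColumns_iff,
    isInEveryBinomialSystem_exampleColumns_iff,
    fun i j c h => eq_of_C_mul_exampleBinomial_eq (c := 1) (c' := c) one_ne_zero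
      (by rwa [C_1, one_mul]),
    span_range_exampleBinomial,
    minimal_system_iff (fun _ => id) (fun _ => IsBinomialSystem.isHomogeneousSystem)⟩
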